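/- Let $d\ge 1$ and $0<\delta<1/2$. For a finite (positive) Borel measure $\mu$ on $\mathbb{R}^d$ put $\widehat\mu(z)=\int_{\mathbb{R}^d} e^{-2\pi i\langle x,z\rangle}\,d\mu(x)$, let $|\cdot|$ denote the Euclidean norm, and for $\theta\in(0,1]$ and $s\ge 0$ let $$\mathcal{J}_{s,\theta}(\mu)=\Big(\int_{\mathbb{R}^d}|\widehat\mu(z)|^{2/\theta}\,|z|^{s/\theta-d}\,dz\Big)^{\theta}\in[0,\infty],\qquad \dim_{\mathrm F}^{\theta}\mu=\sup\{s\ge 0:\mathcal{J}_{s,\theta}(\mu)<\infty\}\in[0,\infty],$$ with the convention that this supremum is $0$ if there is no such $s$. (1) For every $s>0$ there is a constant $C\in(0,\infty)$, depending only on $d$, $\delta$ and $s$, such that for every $\theta\in(0,1]$ and every finite Borel measure $\mu$ on $\mathbb{R}^d$ with support contained in $[\delta,1-\delta]^d$, $$C^{-1}\,\mathcal{D}_{s,\theta}(\mu)\le \mathcal{J}_{s,\theta}(\mu)\le C\,\mathcal{D}_{s,\theta}(\mu),\qquad \mathcal{D}_{s,\theta}(\mu)=\Big(|\widehat\mu(0)|^{2/\theta}+\sum_{z\in\mathbb{Z}^d\setminus\{0\}}|\widehat\mu(z)|^{2/\theta}\,|z|^{s/\theta-d}\Big)^{\theta};$$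 in particular, one of the two quantities is infinite if and only if the other is. (2) Consequently, for every $\theta\in(0,1]$ and every finite Borel measure $\mu$ on $\mathbb{R}^d$ with support contained in $[\delta,1-\delta]^d$, $$\dim_{\mathrm F}^{\theta}\mu=\sup\Big\{s\in\mathbb{R}:\sum_{z\in\mathbb{Z}^d\setminus\{0\}}|\widehat\mu(z)|^{2/\theta}\,|z|^{s/\theta-d}<\infty\Big\},$$ where both sides may be $+\infty$. -/

import Mathlib

open MeasureTheory Set
open scoped ENNReal NNReal RealInnerProductSpace

noncomputable section

namespace FourierCoeffs

/-- The Fourier transform `μ̂(z) = ∫ exp(-2πi ⟪x, z⟫) dμ(x)` of a measure on `ℝ^d`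
(`Real.fourierChar t = exp(2πi t)`). -/
def fourierTransform {d : ℕ} (μ : Measure (EuclideanSpace ℝ (Fin d)))
    (z : EuclideanSpace ℝ (Fin d)) : ℂ :=
  ∫ x, (Real.fourierChar (-⟪x, z⟫) : ℂ) ∂μ

/-- The `(s, θ)`-energy `(∫ |μ̂(z)|^(2/θ) |z|^(s/θ - d) dz)^θ`, for `θ > 0`, with values in
`[0, ∞]`; `|·|` is the Euclidean norm and `dz` is Lebesgue measure. -/
def energy {d : ℕ} (s θ : ℝ) (μ : Measure (EuclideanSpace ℝ (Fin d))) : ℝ≥0∞ :=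
  (∫⁻ z, ‖fourierTransform μ z‖ₑ ^ (2 / θ) * ‖z‖ₑ ^ (s / θ - d)) ^ θ

/-- The Fourier spectrum `sup {s ≥ 0 : energy s θ μ < ∞}` at `θ > 0`, with values in `[0, ∞]`;
the supremum of the empty set is `0`. -/
def fourierSpectrum {d : ℕ} (θ : ℝ) (μ : Measure (EuclideanSpace ℝ (Fin d))) : ℝ≥0∞ :=
  ⨆ (s : ℝ≥0) (_ : energy s θ μ < ∞), (s : ℝ≥0∞)

/-- An element of `ℤ^d` as a point of `ℝ^d`. -/
def latticePoint {d : ℕ} (z : Fin d → ℤ) : EuclideanSpace ℝ (Fin d) :=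
  WithLp.toLp 2 fun i => (z i : ℝ)

/-- The lattice sum `∑ |μ̂(z)|^(2/θ) |z|^(s/θ - d)` over `z ∈ ℤ^d \ {0}`, with values in
`[0, ∞]`. -/
def latticeSum {d : ℕ} (s θ : ℝ) (μ : Measure (EuclideanSpace ℝ (Fin d))) : ℝ≥0∞ :=
  ∑' z : {z : Fin d → ℤ // z ≠ 0},
    ‖fourierTransform μ (latticePoint z.1)‖ₑ ^ (2 / θ) * ‖latticePoint z.1‖ₑ ^ (s / θ - d)

/-- The discrete energy `(|μ̂(0)|^(2/θ) + ∑ |μ̂(z)|^(2/θ) |z|^(s/θ - d))^θ`. -/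
def discreteEnergy {d : ℕ} (s θ : ℝ) (μ : Measure (EuclideanSpace ℝ (Fin d))) : ℝ≥0∞ :=
  (‖fourierTransform μ 0‖ₑ ^ (2 / θ) + latticeSum s θ μ) ^ θ

/-- The closed cube `[δ, 1 - δ]^d` in `ℝ^d`. -/
def innerCube (d : ℕ) (δ : ℝ) : Set (EuclideanSpace ℝ (Fin d)) :=
  {x | ∀ i, x i ∈ Icc δ (1 - δ)}

end FourierCoeffs

end

/-! Let `φ` be a smooth cutoff equal to `1` on `[δ, 1 - δ]` and vanishing off `(0, 1)`, and let `ψ`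
be its Fourier transform. For `t` in `[δ, 1 - δ]` the character `z ↦ exp(-2πitz)` is reproduced by
`ψ` in two ways: by convolution over `ℝ` (Fourier inversion) and by summation over `ℤ` (Poisson
summation). Tensoring and integrating against `μ` bounds `|μ̂(z)|` by averages of `|μ̂|` over `ℝ^d`
and over `ℤ^d`, against one rapidly decaying kernel (`exists_enorm_fourierTransform_le`).

A weighted Schur test (`lintegral_rpow_mul_weight_le`) with `p = 2/θ` turns these bounds into
two-sided comparisons of weighted `L^p` norms. Its constant is `M ^ p` with `M` independent of `p`,
so the outer power `θ` leaves `M ^ 2`, uniform in `θ`.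

The Schur test needs the slowly varying weight `max 1 |z|`. Passing to `|z|` only affects the unit
ball. There `|z|^(s/θ - d) ≤ |z|^(s - d)` is integrable and `|μ̂| ≤ |μ̂(0)|`; conversely `|μ̂| ≥
|μ̂(0)|/2` near the origin, so the energy controls the mass
(`exists_enorm_fourierTransform_zero_rpow_le`).

The spectrum formula follows because finiteness agrees for each `s > 0`, and every `s < 0` gives a
convergent lattice sum. -/

open scoped SchwartzMap FourierTransform

namespace FourierCoeffs

/-! ### Reproducing formulas on the line -/

/-- A smooth cutoff on the line: equal to `1` on `[δ, 1 - δ]` and supported in `(0, 1)`. -/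
theorem exists_cutoff {δ : ℝ} (hδ : 0 < δ) (hδ' : δ < 1 / 2) :
    ∃ φ : ℝ → ℂ, ContDiff ℝ (⊤ : ℕ∞) φ ∧ HasCompactSupport φ ∧
      (∀ t ∈ Icc δ (1 - δ), φ t = 1) ∧ ∀ t ∉ Ioo (0 : ℝ) 1, φ t = 0 := by
  let b : ContDiffBump (1 / 2 : ℝ) :=
    { rIn := 1 / 2 - δ
      rOut := 1 / 2 - δ / 2
      rIn_pos := by linarith
      rIn_lt_rOut := by linarith }
  refine ⟨fun t => (b t : ℂ), Complex.ofRealCLM.contDiff.comp b.contDiff, ?_, ?_, ?_⟩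
  · exact b.hasCompactSupport.comp_left (g := fun t : ℝ => (t : ℂ)) rfl
  · intro t ht
    have : b t = 1 := b.one_of_mem_closedBall (by
      rw [Real.closedBall_eq_Icc]
      constructor <;> simp only [b] <;> linarith [ht.1, ht.2])
    simp [this]
  · intro t ht
    have : b t = 0 := by
      apply b.zero_of_le_dist
      rw [Real.dist_eq]
      by_contra! h
      rw [abs_lt] at h
      exact ht ⟨by simp only [b] at h; linarith, by simp only [b] at h; linarith⟩
    simp [this]

theorem fourier_mul_fourierChar (φ : ℝ → ℂ) (z w : ℝ) :
    𝓕 (fun x => φ x * (Real.fourierChar (-(x * z)) : ℂ)) w = 𝓕 φ (w + z) := by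
  rw [Real.fourier_real_eq, Real.fourier_real_eq]
  congr 1 with x
  have : -(x * (w + z)) = -(x * w) + -(x * z) := by ring
  rw [this, AddChar.map_add_eq_mul]
  simp only [Circle.smul_def, Circle.coe_mul, smul_eq_mul]
  ring

theorem fourier_unitAddCircle_eq (k : ℤ) (t : ℝ) :
    (fourier k (t : UnitAddCircle) : ℂ) = Real.fourierChar (t * k) := by
  rw [fourier_coe_apply, Real.fourierChar_apply]
  congr 1
  push_cast
  ring

/-- The character `t ↦ exp(2πit)` of the line, as a complex-valued function. -/
noncomputable def unitExp (t : ℝ) : ℂ := (Real.fourierChar t : ℂ)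

theorem continuous_unitExp : Continuous unitExp :=
  continuous_subtype_val.comp Real.continuous_fourierChar

@[simp]
theorem norm_unitExp (t : ℝ) : ‖unitExp t‖ = 1 := Circle.norm_coe _

@[simp]
theorem unitExp_zero : unitExp 0 = 1 := by simp [unitExp]

theorem unitExp_add (s t : ℝ) : unitExp (s + t) = unitExp s * unitExp t := by
  simp [unitExp, AddChar.map_add_eq_mul]

theorem unitExp_sum {ι : Type*} (s : Finset ι) (f : ι → ℝ) :
    unitExp (∑ i ∈ s, f i) = ∏ i ∈ s, unitExp (f i) := by
  classical
  induction s using Finset.induction_on with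
  | empty => simp
  | insert a s ha ih => rw [Finset.sum_insert ha, Finset.prod_insert ha, unitExp_add, ih]

theorem norm_unitExp_sub_one_le (t : ℝ) : ‖unitExp t - 1‖ ≤ 2 * Real.pi * |t| := by
  have h := Real.norm_exp_I_mul_ofReal_sub_one_le (x := 2 * Real.pi * t)
  rw [unitExp, Real.fourierChar_apply, mul_comm _ Complex.I]
  refine h.trans_eq ?_
  rw [Real.norm_eq_abs, abs_mul, abs_of_pos Real.two_pi_pos]

/-- Take `ψ = 𝓕 φ`. Poisson summation is applied to `x ↦ φ x * exp(-2πixz)` at the point `t`: each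
`t + n` with `n ≠ 0` lies outside `(0, 1)`, so only `n = 0` survives. The integral formula is
Fourier inversion at `t` after the substitution `y ↦ z - y`. -/
theorem exists_reproducing_kernel {δ : ℝ} (hδ : 0 < δ) (hδ' : δ < 1 / 2) :
    ∃ ψ : 𝓢(ℝ, ℂ),
      (∀ t ∈ Icc δ (1 - δ), ∀ z : ℝ,
        ∑' k : ℤ, ψ (z - k) * unitExp (-(t * k)) = unitExp (-(t * z))) ∧
      (∀ t ∈ Icc δ (1 - δ), ∀ z : ℝ,
        ∫ y : ℝ, ψ (z - y) * unitExp (-(t * y)) = unitExp (-(t * z))) := by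
  simp only [unitExp]
  obtain ⟨φ, hφs, hφc, hφ1, hφ0⟩ := exists_cutoff hδ hδ'
  let Φ : 𝓢(ℝ, ℂ) := hφc.toSchwartzMap hφs
  have hΦ : ⇑Φ = φ := rfl
  refine ⟨𝓕 Φ, fun t ht z => ?_, fun t ht z => ?_⟩
  · let f : ℝ → ℂ := fun x => φ x * (Real.fourierChar (-(x * z)) : ℂ)
    have hfs : ContDiff ℝ (⊤ : ℕ∞) f := by
      refine hφs.mul ?_
      simp only [Real.fourierChar_apply]
      have : ContDiff ℝ (⊤ : ℕ∞) fun x : ℝ => ((2 * Real.pi * -(x * z) : ℝ) : ℂ) :=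
        Complex.ofRealCLM.contDiff.comp
          (contDiff_const.mul (contDiff_id.mul contDiff_const).neg)
      exact (this.mul contDiff_const).cexp
    have hfc : HasCompactSupport f := hφc.mul_right
    have key := SchwartzMap.tsum_eq_tsum_fourier (hfc.toSchwartzMap hfs) t
    have hF : ⇑(hfc.toSchwartzMap hfs) = f := rfl
    rw [hF] at key
    have h1 : ∑' n : ℤ, f (t + n) = Real.fourierChar (-(t * z)) := by
      rw [tsum_eq_single 0]
      · simp [f, hφ1 t ht]
      · intro n hn
        have : φ (t + n) = 0 := by
          apply hφ0
          rintro ⟨h1, h2⟩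
          have h3 : (-1 : ℝ) < n := by linarith [ht.2]
          have h4 : (n : ℝ) < 1 := by linarith [ht.1]
          have h3' : -1 < n := by exact_mod_cast h3
          have h4' : n < 1 := by exact_mod_cast h4
          omega
        simp [f, this]
    -- Poisson summation produces `𝓕 φ (k + z)`; replacing `k` by `-k` gives the convolution form.
    rw [← h1, key, ← (Equiv.neg ℤ).tsum_eq]
    refine tsum_congr fun k => ?_
    rw [fourier_unitAddCircle_eq, SchwartzMap.fourier_coe, SchwartzMap.fourier_coe, hF, hΦ,
      fourier_mul_fourierChar]
    simp only [Equiv.neg_apply, Int.cast_neg, mul_neg, neg_neg, sub_neg_eq_add]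
    rw [add_comm z]
  · have hinv : 𝓕⁻ (𝓕 φ) t = φ t := by
      have := Continuous.fourierInv_fourier_eq hφs.continuous Φ.integrable
        (by simpa only [← SchwartzMap.fourier_coe, hΦ] using (𝓕 Φ).integrable)
      rw [this]
    rw [hφ1 t ht, Real.fourierInv_eq'] at hinv
    rw [← integral_sub_left_eq_self _ volume z]
    have : ∀ y : ℝ, (𝓕 Φ) (z - (z - y)) * (Real.fourierChar (-(t * (z - y))) : ℂ) =
        Real.fourierChar (-(t * z)) *
          (Complex.exp (↑(2 * Real.pi * inner ℝ y t) * Complex.I) • 𝓕 φ y) := by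
      intro y
      have h : -(t * (z - y)) = -(t * z) + t * y := by ring
      rw [h, AddChar.map_add_eq_mul, Circle.coe_mul, sub_sub_cancel, SchwartzMap.fourier_coe, hΦ,
        Real.fourierChar_apply (t * y)]
      simp only [smul_eq_mul, RCLike.inner_apply, conj_trivial]
      ring_nf
    simp_rw [this]
    rw [integral_const_mul, hinv, mul_one]

/-! ### Kernel decay and reproducing inequalities in `ℝ^d` -/

theorem exists_enorm_schwartz_le (ψ : 𝓢(ℝ, ℂ)) (r : ℝ) :
    ∃ C : ℝ≥0, ∀ t, ‖ψ t‖ₑ ≤ C * (1 + ‖t‖ₑ) ^ (-r) := by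
  obtain ⟨N, hN⟩ := exists_nat_ge r
  let A : ℝ := 2 ^ N * ((Finset.Iic (N, 0)).sup fun m => SchwartzMap.seminorm ℝ m.1 m.2) ψ
  refine ⟨A.toNNReal, fun t => ?_⟩
  have h := SchwartzMap.one_add_le_sup_seminorm_apply (𝕜 := ℝ) (m := (N, 0)) (k := N) (n := 0)
    le_rfl le_rfl ψ t
  rw [norm_iteratedFDeriv_zero] at h
  have h1 : (1 : ℝ≥0∞) + ‖t‖ₑ = ENNReal.ofReal (1 + ‖t‖) := by
    rw [ENNReal.ofReal_add zero_le_one (norm_nonneg _), ENNReal.ofReal_one, ofReal_norm]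
  have hpos : 0 < 1 + ‖t‖ := by positivity
  have hA : (A.toNNReal : ℝ≥0∞) = ENNReal.ofReal A := rfl
  rw [h1, ENNReal.ofReal_rpow_of_pos hpos, ← ofReal_norm, hA,
    ← ENNReal.ofReal_mul (by positivity)]
  apply ENNReal.ofReal_le_ofReal
  rw [Real.rpow_neg hpos.le, ← div_eq_mul_inv, le_div_iff₀ (by positivity), mul_comm]
  refine le_trans ?_ h
  gcongr
  rw [← Real.rpow_natCast]
  exact Real.rpow_le_rpow_of_exponent_le (by simp) hN

theorem summable_schwartz_sub_int (ψ : 𝓢(ℝ, ℂ)) (z : ℝ) : Summable fun k : ℤ => ψ (z - k) := by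
  let χ : 𝓢(ℝ, ℂ) := SchwartzMap.compSubConstCLM ℂ z
    (SchwartzMap.compCLMOfContinuousLinearEquiv ℂ (ContinuousLinearEquiv.neg ℝ) ψ)
  have h : ∀ y, χ y = ψ (z - y) := fun y => by
    simp only [χ, SchwartzMap.compSubConstCLM_apply]
    simp
  simp_rw [← h]
  exact summable_of_isBigO (Real.summable_abs_int_rpow one_lt_two)
    ((χ.isBigO_cocompact_rpow (-2)).comp_tendsto Int.tendsto_coe_cofinite)

theorem integral_count_eq_tsum {f : ℤ → ℂ} (hf : Summable f) :
    ∫ k, f k ∂Measure.count = ∑' k, f k := by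
  rw [integral_countable (integrable_count_iff.2 hf.norm)]
  simp [Measure.real]

theorem one_add_sum_le_prod_one_add {ι : Type*} (s : Finset ι) (f : ι → ℝ≥0∞) :
    1 + ∑ i ∈ s, f i ≤ ∏ i ∈ s, (1 + f i) := by
  classical
  induction s using Finset.induction_on with
  | empty => simp
  | insert a s ha ih =>
    rw [Finset.sum_insert ha, Finset.prod_insert ha]
    calc 1 + (f a + ∑ i ∈ s, f i) ≤ (1 + ∑ i ∈ s, f i) + f a * (1 + ∑ i ∈ s, f i) := by
          rw [add_comm (f a), ← add_assoc]
          gcongr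
          exact le_mul_of_one_le_right' le_self_add
      _ = (1 + f a) * (1 + ∑ i ∈ s, f i) := by ring
      _ ≤ _ := by gcongr

theorem enorm_le_sum_enorm {d : ℕ} (x : EuclideanSpace ℝ (Fin d)) : ‖x‖ₑ ≤ ∑ i, ‖x i‖ₑ := by
  have h : x = ∑ i, x i • EuclideanSpace.single i (1 : ℝ) := by
    ext j
    simp [Pi.single_apply]
  calc ‖x‖ₑ = ‖∑ i, x i • EuclideanSpace.single i (1 : ℝ)‖ₑ := by rw [← h]
    _ ≤ ∑ i, ‖x i • EuclideanSpace.single i (1 : ℝ)‖ₑ := enorm_sum_le _ _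
    _ = _ := by
      refine Finset.sum_congr rfl fun i _ => ?_
      rw [enorm_smul]
      simp [← ofReal_norm]

/-- Coordinatewise decay gives decay in the Euclidean norm, since `∏ (1 + |u i|) ≥ 1 + ∑ |u i| ≥ 1 +
|u|`. -/
theorem prod_enorm_schwartz_le {d : ℕ} {ψ : 𝓢(ℝ, ℂ)} {r : ℝ} (hr : 0 ≤ r) {C : ℝ≥0}
    (hC : ∀ t, ‖ψ t‖ₑ ≤ C * (1 + ‖t‖ₑ) ^ (-r)) (u : EuclideanSpace ℝ (Fin d)) :
    ∏ i, ‖ψ (u i)‖ₑ ≤ (C ^ d : ℝ≥0) * (1 + ‖u‖ₑ) ^ (-r) := by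
  calc ∏ i, ‖ψ (u i)‖ₑ ≤ ∏ i, (C : ℝ≥0∞) * (1 + ‖u i‖ₑ) ^ (-r) :=
        Finset.prod_le_prod' fun i _ => hC _
    _ = (C ^ d : ℝ≥0) * (∏ i, (1 + ‖u i‖ₑ)) ^ (-r) := by
      rw [Finset.prod_mul_distrib, ENNReal.prod_rpow_of_ne_top (by simp)]
      simp
    _ ≤ _ := by
      gcongr (C ^ d : ℝ≥0) * ?_
      rw [ENNReal.rpow_neg, ENNReal.rpow_neg, ENNReal.inv_le_inv]
      gcongr
      exact (add_le_add_right (enorm_le_sum_enorm u) 1).trans (one_add_sum_le_prod_one_add _ _)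

theorem unitExp_neg_inner {d : ℕ} (x y : EuclideanSpace ℝ (Fin d)) :
    unitExp (-⟪x, y⟫) = ∏ i, unitExp (-(x i * y i)) := by
  rw [PiLp.inner_apply, ← Finset.sum_neg_distrib, unitExp_sum]
  simp [mul_comm]

theorem fourierTransform_eq_integral_unitExp {d : ℕ} (μ : Measure (EuclideanSpace ℝ (Fin d)))
    (z : EuclideanSpace ℝ (Fin d)) : fourierTransform μ z = ∫ x, unitExp (-⟪x, z⟫) ∂μ := rfl

theorem ae_mem_innerCube {d : ℕ} {δ : ℝ} {μ : Measure (EuclideanSpace ℝ (Fin d))}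
    (hμ : μ.support ⊆ innerCube d δ) : ∀ᵐ x ∂μ, x ∈ innerCube d δ :=
  Filter.mem_of_superset Measure.support_mem_ae hμ

theorem continuous_fourierTransform {d : ℕ} (μ : Measure (EuclideanSpace ℝ (Fin d)))
    [IsFiniteMeasure μ] : Continuous (fourierTransform μ) := by
  refine continuous_of_dominated (F := fun z x => unitExp (-⟪x, z⟫)) (bound := fun _ => 1)
    (fun z => ?_) (fun z => ae_of_all _ fun x => (norm_unitExp _).le) (integrable_const _)
    (ae_of_all _ fun x => continuous_unitExp.comp (by fun_prop))
  exact (continuous_unitExp.comp (by fun_prop)).aestronglyMeasurable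

theorem integrable_mul_unitExp_inner {d : ℕ} (μ : Measure (EuclideanSpace ℝ (Fin d)))
    [IsFiniteMeasure μ] {Z : Type*} [MeasurableSpace Z] {ν : Measure Z} [SFinite ν] {Ψ : Z → ℂ}
    (hΨ : Integrable Ψ ν) {b : Z → EuclideanSpace ℝ (Fin d)} (hb : Measurable b) :
    Integrable (Function.uncurry fun x y => Ψ y * unitExp (-⟪x, b y⟫)) (μ.prod ν) := by
  have hmeas : Measurable fun p : EuclideanSpace ℝ (Fin d) × Z => unitExp (-⟪p.1, b p.2⟫) :=
    continuous_unitExp.measurable.comp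
      (measurable_fst.inner (hb.comp measurable_snd)).neg
  have hΨ' : Integrable (fun p : EuclideanSpace ℝ (Fin d) × Z => Ψ p.2) (μ.prod ν) :=
    hΨ.comp_snd μ
  refine Integrable.mono' hΨ'.norm (hΨ'.aestronglyMeasurable.mul hmeas.aestronglyMeasurable)
    (ae_of_all _ fun p => ?_)
  simp [Function.uncurry]

/-- A reproducing formula on the line, tensored up to `ℝ^d`, bounds the Fourier transform of a
measure on the cube by its average against the tensor power of the kernel. -/
theorem enorm_fourierTransform_le_lintegral_pi {d : ℕ} {δ : ℝ} {Y : Type*} [MeasurableSpace Y]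
    (m : Measure Y) [SigmaFinite m] {ι : Y → ℝ} (hι : Measurable ι) (ψ : 𝓢(ℝ, ℂ))
    (hint : ∀ z, Integrable (fun y => ψ (z - ι y)) m)
    (hrep : ∀ t ∈ Icc δ (1 - δ), ∀ z : ℝ,
      ∫ y, ψ (z - ι y) * unitExp (-(t * ι y)) ∂m = unitExp (-(t * z)))
    (μ : Measure (EuclideanSpace ℝ (Fin d))) [IsFiniteMeasure μ]
    (hμ : μ.support ⊆ innerCube d δ) (z : EuclideanSpace ℝ (Fin d)) :
    ‖fourierTransform μ z‖ₑ ≤ ∫⁻ y : Fin d → Y, (∏ i, ‖ψ (z i - ι (y i))‖ₑ) *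
      ‖fourierTransform μ (WithLp.toLp 2 fun i => ι (y i))‖ₑ ∂Measure.pi fun _ => m := by
  let b : (Fin d → Y) → EuclideanSpace ℝ (Fin d) := fun y => WithLp.toLp 2 fun i => ι (y i)
  have hb : Measurable b := (WithLp.measurable_toLp 2 _).comp (by fun_prop)
  let Ψ : (Fin d → Y) → ℂ := fun y => ∏ i, ψ (z i - ι (y i))
  have hΨ : Integrable Ψ (Measure.pi fun _ => m) :=
    Integrable.fintype_prod (f := fun i y => ψ (z i - ι y)) fun i => hint (z i)
  have hrepd : ∀ x ∈ innerCube d δ, ∫ y, Ψ y * unitExp (-⟪x, b y⟫)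
      ∂Measure.pi (fun _ => m) = unitExp (-⟪x, z⟫) := by
    intro x hx
    simp only [Ψ, unitExp_neg_inner, b, ← Finset.prod_mul_distrib]
    rw [integral_fintype_prod_eq_prod
      (f := fun i y => ψ (z i - ι y) * unitExp (-(x i * ι y)))]
    exact Finset.prod_congr rfl fun i _ => hrep _ (hx i) _
  have hkey : fourierTransform μ z =
      ∫ y, Ψ y * fourierTransform μ (b y) ∂Measure.pi (fun _ => m) := by
    calc fourierTransform μ z = ∫ x, ∫ y, Ψ y * unitExp (-⟪x, b y⟫)
          ∂Measure.pi (fun _ => m) ∂μ := by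
          refine integral_congr_ae ?_
          filter_upwards [ae_mem_innerCube hμ] with x hx using (hrepd x hx).symm
      _ = ∫ y, ∫ x, Ψ y * unitExp (-⟪x, b y⟫) ∂μ ∂Measure.pi (fun _ => m) := by
          exact integral_integral_swap (integrable_mul_unitExp_inner μ hΨ hb)
      _ = _ := by simp_rw [integral_const_mul, fourierTransform_eq_integral_unitExp]
  rw [hkey]
  refine (enorm_integral_le_lintegral_enorm _).trans_eq ?_
  simp only [enorm_mul, Ψ, b]
  congr 1 with y
  congr 1
  simp only [← ofReal_norm, norm_prod]
  rw [ENNReal.ofReal_prod_of_nonneg fun _ _ => norm_nonneg _]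

theorem pi_count (d : ℕ) :
    Measure.pi (fun _ : Fin d => (Measure.count : Measure ℤ)) = Measure.count := by
  refine Measure.ext_of_singleton fun k => ?_
  rw [Measure.pi_singleton]
  simp

/-- Both the integral and the lattice reproducing inequality for the Fourier transform of a
measure on the cube `[δ, 1 - δ]^d`, with a kernel of arbitrary polynomial decay. -/
theorem exists_enorm_fourierTransform_le (d : ℕ) {δ : ℝ} (hδ : 0 < δ) (hδ' : δ < 1 / 2) {r : ℝ}
    (hr : 0 ≤ r) :
    ∃ C : ℝ≥0, ∀ (μ : Measure (EuclideanSpace ℝ (Fin d))) [IsFiniteMeasure μ],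
      μ.support ⊆ innerCube d δ → ∀ z : EuclideanSpace ℝ (Fin d),
        ‖fourierTransform μ z‖ₑ ≤
          ∫⁻ y, C * (1 + ‖z - y‖ₑ) ^ (-r) * ‖fourierTransform μ y‖ₑ ∧
        ‖fourierTransform μ z‖ₑ ≤ ∫⁻ k, C * (1 + ‖z - latticePoint k‖ₑ) ^ (-r) *
          ‖fourierTransform μ (latticePoint k)‖ₑ ∂Measure.count := by
  obtain ⟨ψ, hsum, hcont⟩ := exists_reproducing_kernel hδ hδ'
  obtain ⟨C, hC⟩ := exists_enorm_schwartz_le ψ r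
  refine ⟨C ^ d, fun μ _ hμ z => ⟨?_, ?_⟩⟩
  · refine (enorm_fourierTransform_le_lintegral_pi volume measurable_id ψ
      (fun z => ψ.integrable.comp_sub_left z) hcont μ hμ z).trans ?_
    rw [← (PiLp.volume_preserving_toLp (Fin d)).lintegral_comp_emb
      (MeasurableEquiv.toLp 2 (Fin d → ℝ)).measurableEmbedding]
    refine lintegral_mono fun y => ?_
    gcongr
    · exact prod_enorm_schwartz_le hr hC (z - WithLp.toLp 2 y)
    · rfl
  · refine (enorm_fourierTransform_le_lintegral_pi Measure.count (ι := fun k : ℤ => (k : ℝ))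
      (measurable_of_countable _) ψ
      (fun z => integrable_count_iff.2 (summable_schwartz_sub_int ψ z).norm)
      (fun t ht z => ?_) μ hμ z).trans ?_
    · rw [integral_count_eq_tsum, hsum t ht z]
      refine Summable.of_norm ?_
      simpa using (summable_schwartz_sub_int ψ z).norm
    · rw [pi_count]
      refine lintegral_mono fun y => ?_
      gcongr
      · exact prod_enorm_schwartz_le hr hC (z - latticePoint y)
      · rfl

/-! ### Slowly varying weights and the weighted Schur test -/

section Weights

variable {E : Type*} [NormedAddCommGroup E]

theorem max_one_enorm_le_mul (x y : E) : max 1 ‖x‖ₑ ≤ (1 + ‖x - y‖ₑ) * max 1 ‖y‖ₑ := by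
  refine max_le ?_ ?_
  · exact one_le_mul (by simp) (le_max_left _ _)
  · calc ‖x‖ₑ = ‖(x - y) + y‖ₑ := by rw [sub_add_cancel]
      _ ≤ ‖x - y‖ₑ + ‖y‖ₑ := enorm_add_le _ _
      _ ≤ ‖x - y‖ₑ * max 1 ‖y‖ₑ + 1 * max 1 ‖y‖ₑ := by
        gcongr
        · exact le_mul_of_one_le_right' (le_max_left _ _)
        · rw [one_mul]; exact le_max_right _ _
      _ = _ := by ring

theorem one_add_enorm_le_mul (x y : E) : 1 + ‖x‖ₑ ≤ (1 + ‖y‖ₑ) * (1 + ‖x + y‖ₑ) := by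
  have : ‖x‖ₑ ≤ ‖x + y‖ₑ + ‖y‖ₑ := by
    calc ‖x‖ₑ = ‖(x + y) - y‖ₑ := by rw [add_sub_cancel_right]
      _ ≤ _ := enorm_sub_le
  calc 1 + ‖x‖ₑ ≤ 1 + (‖x + y‖ₑ + ‖y‖ₑ) := by gcongr
    _ ≤ 1 + (‖x + y‖ₑ + ‖y‖ₑ) + ‖y‖ₑ * ‖x + y‖ₑ := le_self_add
    _ = _ := by ring

theorem one_add_enorm_ne_zero (x : E) : 1 + ‖x‖ₑ ≠ 0 := by simp

theorem one_add_enorm_ne_top (x : E) : 1 + ‖x‖ₑ ≠ ∞ := by simp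

theorem max_one_enorm_ne_zero (x : E) : max 1 ‖x‖ₑ ≠ 0 :=
  (zero_lt_one.trans_le (le_max_left _ _)).ne'

theorem max_one_enorm_ne_top (x : E) : max 1 ‖x‖ₑ ≠ ∞ := by simp

/-- This is `max_one_enorm_le_mul` with `x` and `y` exchanged, raised to the power `D` and
rearranged. -/
theorem max_one_enorm_rpow_neg_le (x y : E) {D : ℝ} (hD : 0 ≤ D) :
    max 1 ‖x‖ₑ ^ (-D) ≤ (1 + ‖x - y‖ₑ) ^ D * max 1 ‖y‖ₑ ^ (-D) := by
  have h := ENNReal.rpow_le_rpow (max_one_enorm_le_mul y x) hD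
  rw [ENNReal.mul_rpow_of_nonneg _ _ hD, ← neg_sub, enorm_neg] at h
  have hx := ENNReal.rpow_add D (-D) (max_one_enorm_ne_zero x) (max_one_enorm_ne_top x)
  have hy := ENNReal.rpow_add D (-D) (max_one_enorm_ne_zero y) (max_one_enorm_ne_top y)
  rw [add_neg_cancel, ENNReal.rpow_zero] at hx hy
  calc max 1 ‖x‖ₑ ^ (-D) = max 1 ‖y‖ₑ ^ D * (max 1 ‖y‖ₑ ^ (-D) * max 1 ‖x‖ₑ ^ (-D)) := by
        rw [← mul_assoc, ← hy, one_mul]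
    _ ≤ (1 + ‖x - y‖ₑ) ^ D * max 1 ‖x‖ₑ ^ D * (max 1 ‖y‖ₑ ^ (-D) * max 1 ‖x‖ₑ ^ (-D)) := by
        gcongr
    _ = (1 + ‖x - y‖ₑ) ^ D * max 1 ‖y‖ₑ ^ (-D) * (max 1 ‖x‖ₑ ^ D * max 1 ‖x‖ₑ ^ (-D)) := by ring
    _ = _ := by rw [← hx, mul_one]

end Weights

/-- Jensen's inequality for an unnormalised weight. -/
theorem lintegral_mul_rpow_le {Y : Type*} [MeasurableSpace Y] {ν : Measure Y} {p : ℝ} (hp : 1 < p)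
    {K f : Y → ℝ≥0∞} (hK : Measurable K) (hf : Measurable f) :
    (∫⁻ y, K y * f y ∂ν) ^ p ≤ (∫⁻ y, K y ∂ν) ^ (p - 1) * ∫⁻ y, K y * f y ^ p ∂ν := by
  have hp0 : 0 < p := zero_lt_one.trans hp
  have hpq := Real.HolderConjugate.conjExponent hp
  set q := p.conjExponent with hq
  -- Hölder for the factorisation `K = K^(1/q) * K^(1/p)`, with `1/p + 1/q = 1`.
  have hsplit : ∀ y, K y * f y = K y ^ (1 / q) * (K y ^ (1 / p) * f y) := fun y => by
    rw [← mul_assoc, ← ENNReal.rpow_add_of_nonneg _ _ hpq.symm.one_div_nonneg hpq.one_div_nonneg,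
      add_comm, one_div, one_div, hpq.inv_add_inv_eq_one, ENNReal.rpow_one]
  have h := ENNReal.lintegral_mul_le_Lp_mul_Lq ν hpq.symm (f := fun y => K y ^ (1 / q))
    (g := fun y => K y ^ (1 / p) * f y) (by fun_prop) (by fun_prop)
  simp only [Pi.mul_apply, ← hsplit] at h
  have hq1 : ∀ y, (K y ^ (1 / q)) ^ q = K y := fun y => by
    rw [← ENNReal.rpow_mul, one_div_mul_cancel hpq.symm.ne_zero, ENNReal.rpow_one]
  have hp1 : ∀ y, (K y ^ (1 / p) * f y) ^ p = K y * f y ^ p := fun y => by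
    rw [ENNReal.mul_rpow_of_nonneg _ _ hp0.le, ← ENNReal.rpow_mul, one_div_mul_cancel hp0.ne',
      ENNReal.rpow_one]
  simp only [hq1, hp1] at h
  refine (ENNReal.rpow_le_rpow h hp0.le).trans_eq ?_
  rw [ENNReal.mul_rpow_of_nonneg _ _ hp0.le, ← ENNReal.rpow_mul, ← ENNReal.rpow_mul,
    one_div_mul_cancel hp0.ne', ENNReal.rpow_one]
  congr 2
  rw [hq, Real.conjExponent]
  field_simp

variable {d : ℕ}

/-- A weighted Schur test: if `g` is dominated by its average over `(Y, ν₂)` against a rapidly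
decaying kernel, then the weighted `L^p` norm of `g` over `(X, ν₁)` is controlled by that over
`(Y, ν₂)`, with a constant of the form `M ^ p`. -/
theorem lintegral_rpow_mul_weight_le {X Y : Type*} [MeasurableSpace X] [MeasurableSpace Y]
    {ν₁ : Measure X} {ν₂ : Measure Y} [SFinite ν₁] [SFinite ν₂]
    {a : X → EuclideanSpace ℝ (Fin d)} {b : Y → EuclideanSpace ℝ (Fin d)}
    (ha : Measurable a) (hb : Measurable b) {g : EuclideanSpace ℝ (Fin d) → ℝ≥0∞}
    (hg : Measurable g) {C M : ℝ≥0∞} {τ D p : ℝ} (hτ : 0 ≤ τ) (hD : 0 ≤ D) (hp : 1 < p)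
    (hrep : ∀ z, g z ≤ ∫⁻ y, C * (1 + ‖z - b y‖ₑ) ^ (-(τ + D + D + 1)) * g (b y) ∂ν₂)
    (hM₁ : ∀ z, ∫⁻ x, C * (1 + ‖z - a x‖ₑ) ^ (-(D + 1)) ∂ν₁ ≤ M)
    (hM₂ : ∀ z, ∫⁻ y, C * (1 + ‖z - b y‖ₑ) ^ (-(D + 1)) ∂ν₂ ≤ M) :
    ∫⁻ x, g (a x) ^ p * max 1 ‖a x‖ₑ ^ (τ * p - D) ∂ν₁ ≤
      M ^ p * ∫⁻ y, g (b y) ^ p * max 1 ‖b y‖ₑ ^ (τ * p - D) ∂ν₂ := by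
  have hp0 : 0 < p := zero_lt_one.trans hp
  -- The part of the weight that grows with `p` is put inside the `p`-th power. Moving it from `z`
  -- to `b y` before Jensen then costs `τ` powers of decay, whatever `p` is; the remaining `max 1
  -- |z| ^ (-D)` costs `D` more after Jensen. The exponent `D + 1` is left for integrability.
  have hsplit : ∀ z : EuclideanSpace ℝ (Fin d), g z ^ p * max 1 ‖z‖ₑ ^ (τ * p - D) =
      (g z * max 1 ‖z‖ₑ ^ τ) ^ p * max 1 ‖z‖ₑ ^ (-D) := fun z => by
    rw [ENNReal.mul_rpow_of_nonneg _ _ hp0.le, ← ENNReal.rpow_mul, mul_assoc,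
      ← ENNReal.rpow_add _ _ (max_one_enorm_ne_zero z) (max_one_enorm_ne_top z), ← sub_eq_add_neg]
  have hpoint : ∀ z, g z ^ p * max 1 ‖z‖ₑ ^ (τ * p - D) ≤ M ^ (p - 1) *
      ∫⁻ y, C * (1 + ‖z - b y‖ₑ) ^ (-(D + 1)) *
        (g (b y) ^ p * max 1 ‖b y‖ₑ ^ (τ * p - D)) ∂ν₂ := by
    intro z
    have h1 : g z * max 1 ‖z‖ₑ ^ τ ≤ ∫⁻ y, C * (1 + ‖z - b y‖ₑ) ^ (-(D + D + 1)) *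
        (g (b y) * max 1 ‖b y‖ₑ ^ τ) ∂ν₂ := by
      calc g z * max 1 ‖z‖ₑ ^ τ
          ≤ (∫⁻ y, C * (1 + ‖z - b y‖ₑ) ^ (-(τ + D + D + 1)) * g (b y) ∂ν₂) * max 1 ‖z‖ₑ ^ τ := by
            gcongr
            exact hrep z
        _ = ∫⁻ y, C * (1 + ‖z - b y‖ₑ) ^ (-(τ + D + D + 1)) * g (b y) * max 1 ‖z‖ₑ ^ τ ∂ν₂ :=
            (lintegral_mul_const _ (by fun_prop)).symm
        _ ≤ _ := by
            refine lintegral_mono fun y => ?_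
            have h2 := ENNReal.rpow_le_rpow (max_one_enorm_le_mul z (b y)) hτ
            rw [ENNReal.mul_rpow_of_nonneg _ _ hτ] at h2
            have h3 := ENNReal.rpow_add (-(τ + D + D + 1)) τ (one_add_enorm_ne_zero (z - b y))
              (one_add_enorm_ne_top _)
            rw [show -(τ + D + D + 1) + τ = -(D + D + 1) by ring] at h3
            rw [h3]
            calc C * (1 + ‖z - b y‖ₑ) ^ (-(τ + D + D + 1)) * g (b y) * max 1 ‖z‖ₑ ^ τ
                ≤ C * (1 + ‖z - b y‖ₑ) ^ (-(τ + D + D + 1)) * g (b y) *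
                  ((1 + ‖z - b y‖ₑ) ^ τ * max 1 ‖b y‖ₑ ^ τ) := by gcongr
              _ = _ := by ring
    have h2 : ∫⁻ y, C * (1 + ‖z - b y‖ₑ) ^ (-(D + D + 1)) ∂ν₂ ≤ M := by
      refine (lintegral_mono fun y => ?_).trans (hM₂ z)
      gcongr
      · simp
      · linarith
    rw [hsplit z]
    calc (g z * max 1 ‖z‖ₑ ^ τ) ^ p * max 1 ‖z‖ₑ ^ (-D)
        ≤ (∫⁻ y, C * (1 + ‖z - b y‖ₑ) ^ (-(D + D + 1)) *
            (g (b y) * max 1 ‖b y‖ₑ ^ τ) ∂ν₂) ^ p * max 1 ‖z‖ₑ ^ (-D) := by gcongr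
      _ ≤ (∫⁻ y, C * (1 + ‖z - b y‖ₑ) ^ (-(D + D + 1)) ∂ν₂) ^ (p - 1) *
            (∫⁻ y, C * (1 + ‖z - b y‖ₑ) ^ (-(D + D + 1)) *
            (g (b y) * max 1 ‖b y‖ₑ ^ τ) ^ p ∂ν₂) * max 1 ‖z‖ₑ ^ (-D) := by
          gcongr
          exact lintegral_mul_rpow_le hp (by fun_prop) (by fun_prop)
      _ ≤ M ^ (p - 1) * (∫⁻ y, C * (1 + ‖z - b y‖ₑ) ^ (-(D + D + 1)) *
            (g (b y) * max 1 ‖b y‖ₑ ^ τ) ^ p ∂ν₂) * max 1 ‖z‖ₑ ^ (-D) := by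
          gcongr
      _ = M ^ (p - 1) * ∫⁻ y, C * (1 + ‖z - b y‖ₑ) ^ (-(D + D + 1)) *
            (g (b y) * max 1 ‖b y‖ₑ ^ τ) ^ p * max 1 ‖z‖ₑ ^ (-D) ∂ν₂ := by
          rw [mul_assoc, lintegral_mul_const _ (by fun_prop)]
      _ ≤ _ := by
          gcongr M ^ (p - 1) * ?_
          refine lintegral_mono fun y => ?_
          rw [hsplit (b y)]
          have h3 := ENNReal.rpow_add (-(D + D + 1)) D (one_add_enorm_ne_zero (z - b y))
            (one_add_enorm_ne_top _)
          rw [show -(D + D + 1) + D = -(D + 1) by ring] at h3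
          rw [h3]
          calc _ ≤ C * (1 + ‖z - b y‖ₑ) ^ (-(D + D + 1)) * (g (b y) * max 1 ‖b y‖ₑ ^ τ) ^ p *
                ((1 + ‖z - b y‖ₑ) ^ D * max 1 ‖b y‖ₑ ^ (-D)) := by
                gcongr
                exact max_one_enorm_rpow_neg_le _ _ hD
            _ = _ := by ring
  calc ∫⁻ x, g (a x) ^ p * max 1 ‖a x‖ₑ ^ (τ * p - D) ∂ν₁
      ≤ ∫⁻ x, M ^ (p - 1) * ∫⁻ y, C * (1 + ‖a x - b y‖ₑ) ^ (-(D + 1)) *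
        (g (b y) ^ p * max 1 ‖b y‖ₑ ^ (τ * p - D)) ∂ν₂ ∂ν₁ := lintegral_mono fun x => hpoint _
    _ = M ^ (p - 1) * ∫⁻ x, ∫⁻ y, C * (1 + ‖a x - b y‖ₑ) ^ (-(D + 1)) *
        (g (b y) ^ p * max 1 ‖b y‖ₑ ^ (τ * p - D)) ∂ν₂ ∂ν₁ := by
        rw [lintegral_const_mul]
        exact Measurable.lintegral_prod_right' (f := fun q : X × Y =>
          C * (1 + ‖a q.1 - b q.2‖ₑ) ^ (-(D + 1)) *
          (g (b q.2) ^ p * max 1 ‖b q.2‖ₑ ^ (τ * p - D))) (by fun_prop)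
    -- Tonelli, and the symmetry of the kernel, bring the `ν₁` mass bound `hM₁` into play; it
    -- supplies the last factor `M`.
    _ = M ^ (p - 1) * ∫⁻ y, (∫⁻ x, C * (1 + ‖b y - a x‖ₑ) ^ (-(D + 1)) ∂ν₁) *
        (g (b y) ^ p * max 1 ‖b y‖ₑ ^ (τ * p - D)) ∂ν₂ := by
        rw [lintegral_lintegral_swap (by simp only [Function.uncurry_def]; fun_prop)]
        congr 2 with y
        rw [← lintegral_mul_const _ (by fun_prop)]
        congr 1 with x
        rw [← neg_sub, enorm_neg]
    _ ≤ M ^ (p - 1) * ∫⁻ y, M * (g (b y) ^ p * max 1 ‖b y‖ₑ ^ (τ * p - D)) ∂ν₂ := by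
        gcongr with y
        exact hM₁ _
    _ = _ := by
        rw [lintegral_const_mul _ (by fun_prop), ← mul_assoc]
        congr 1
        nth_rw 2 [← ENNReal.rpow_one M]
        rw [← ENNReal.rpow_add_of_nonneg _ _ (by linarith) zero_le_one, sub_add_cancel]

/-! ### Kernel mass over `ℝ^d` and over the lattice -/

theorem measurable_latticePoint : Measurable (latticePoint : (Fin d → ℤ) → _) :=
  measurable_of_countable _

theorem lintegral_one_add_enorm_rpow_neg_lt_top {r : ℝ} (hr : d < r) :
    ∫⁻ y : EuclideanSpace ℝ (Fin d), (1 + ‖y‖ₑ) ^ (-r) < ∞ := by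
  have h := finite_integral_one_add_norm (E := EuclideanSpace ℝ (Fin d)) (μ := volume) (r := r)
    (by simpa using hr)
  refine (lintegral_mono fun y => ?_).trans_lt h
  rw [← ENNReal.ofReal_rpow_of_pos (by positivity), ENNReal.ofReal_add zero_le_one (norm_nonneg _),
    ENNReal.ofReal_one, ofReal_norm]

theorem summable_one_add_abs_int_rpow_neg {r : ℝ} (hr : 1 < r) :
    Summable fun k : ℤ => (1 + |(k : ℝ)|) ^ (-r) := by
  -- The indicator of `0` pays for the term `k = 0`, where `|0| ^ (-r)` takes the value `0` but the
  -- left side is `1`.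
  refine (((Real.summable_abs_int_rpow hr).add (summable_of_hasFiniteSupport
    (f := fun k : ℤ => if k = 0 then (1 : ℝ) else 0) ?_))).of_nonneg_of_le
    (fun k => by positivity) fun k => ?_
  · exact (Set.finite_singleton 0).subset fun k hk => by
      by_contra h
      simp_all
  · by_cases hk : k = 0
    · subst hk
      simp [Real.zero_rpow (by linarith : -r ≠ 0)]
    · have : 0 < |(k : ℝ)| := by positivity
      simp only [hk, if_false, add_zero]
      exact Real.rpow_le_rpow_of_nonpos this (by linarith) (by linarith)

/-- As `|k i| ≤ |k|`, the summand is at most `∏ (1 + |k i|) ^ (-(r/d))`, a product of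
one-dimensional series that converge because `r/d > 1`. -/
theorem lintegral_one_add_enorm_latticePoint_lt_top (hd : 0 < d) {r : ℝ} (hr : d < r) :
    ∫⁻ k : Fin d → ℤ, (1 + ‖latticePoint k‖ₑ) ^ (-r) ∂Measure.count < ∞ := by
  have hd' : (0 : ℝ) < d := by exact_mod_cast hd
  have hr0 : 0 < r := hd'.trans hr
  have h1 : Integrable (fun k : ℤ => (1 + |(k : ℝ)|) ^ (-(r / d))) Measure.count :=
    integrable_count_iff.2 (summable_one_add_abs_int_rpow_neg ((one_lt_div hd').2 hr)).norm
  have h2 := (Integrable.fintype_prod (ι := Fin d) fun _ => h1).hasFiniteIntegral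
  rw [pi_count] at h2
  refine (lintegral_mono fun k => ?_).trans_lt h2
  beta_reduce
  rw [Real.enorm_of_nonneg (by positivity),
    ENNReal.ofReal_prod_of_nonneg fun _ _ => by positivity]
  calc (1 + ‖latticePoint k‖ₑ) ^ (-r)
      = ∏ _i : Fin d, (1 + ‖latticePoint k‖ₑ) ^ (-(r / d)) := by
        rw [Finset.prod_const, Finset.card_univ, Fintype.card_fin, ← ENNReal.rpow_mul_natCast]
        congr 1
        field_simp
    _ ≤ _ := by
        refine Finset.prod_le_prod' fun i _ => ?_
        have h3 : ‖(k i : ℝ)‖ ≤ ‖latticePoint k‖ := PiLp.norm_apply_le (latticePoint k) i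
        rw [← ENNReal.ofReal_rpow_of_pos (by positivity), ENNReal.ofReal_add zero_le_one
          (abs_nonneg _), ENNReal.ofReal_one, ENNReal.rpow_neg, ENNReal.rpow_neg,
          ENNReal.inv_le_inv, ← ofReal_norm]
        gcongr
        exact h3

/-- The integer part of `z` is absorbed by reindexing the lattice; the fractional part has norm at
most `d` and costs the factor `(1 + d) ^ r`. -/
theorem lintegral_one_add_enorm_sub_latticePoint_le {r : ℝ} (hr : 0 ≤ r)
    (z : EuclideanSpace ℝ (Fin d)) :
    ∫⁻ k : Fin d → ℤ, (1 + ‖z - latticePoint k‖ₑ) ^ (-r) ∂Measure.count ≤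
      (1 + (d : ℝ≥0∞)) ^ r * ∫⁻ k : Fin d → ℤ, (1 + ‖latticePoint k‖ₑ) ^ (-r) ∂Measure.count := by
  let n : Fin d → ℤ := fun i => ⌊z i⌋
  let f : EuclideanSpace ℝ (Fin d) := z - latticePoint n
  have hf : ‖f‖ₑ ≤ d := by
    calc ‖f‖ₑ ≤ ∑ i, ‖f i‖ₑ := enorm_le_sum_enorm f
      _ ≤ ∑ _i : Fin d, 1 := by
        refine Finset.sum_le_sum fun i _ => ?_
        have : f i = Int.fract (z i) := rfl
        rw [this, ← ofReal_norm, ENNReal.ofReal_le_one, Real.norm_of_nonneg (Int.fract_nonneg _)]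
        exact (Int.fract_lt_one _).le
      _ = d := by simp
  rw [lintegral_count, lintegral_count, ← (Equiv.subLeft n).tsum_eq, ← ENNReal.tsum_mul_left]
  refine ENNReal.tsum_le_tsum fun k => ?_
  have h1 : z - latticePoint (Equiv.subLeft n k) = latticePoint k + f := by
    ext i
    simp [f, latticePoint]
    ring
  have hne : (1 + (d : ℝ≥0∞)) ≠ 0 := by simp
  have hnt : (1 + (d : ℝ≥0∞)) ≠ ∞ := by simp
  rw [h1, ENNReal.rpow_neg, ENNReal.rpow_neg, ← div_eq_mul_inv, ← ENNReal.inv_div (by simp)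
    (by simp [hne, hnt]), ENNReal.inv_le_inv, ENNReal.div_le_iff (by simp [hne, hnt])
    (by simp [hne, hnt]),
    ← ENNReal.mul_rpow_of_nonneg _ _ hr]
  gcongr
  refine (one_add_enorm_le_mul (latticePoint k) f).trans ?_
  rw [mul_comm]
  gcongr

/-! ### Comparison of the truncated integral with the lattice sum -/

/-- The energy integral with the weight `|z|` replaced by `max 1 |z|`. -/
noncomputable def truncatedIntegral (s θ : ℝ) (μ : Measure (EuclideanSpace ℝ (Fin d))) : ℝ≥0∞ :=
  ∫⁻ z, ‖fourierTransform μ z‖ₑ ^ (2 / θ) * max 1 ‖z‖ₑ ^ (s / θ - d)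

theorem latticePoint_zero : latticePoint (0 : Fin d → ℤ) = 0 := by
  ext i
  simp [latticePoint]

theorem one_le_enorm_latticePoint {k : Fin d → ℤ} (hk : k ≠ 0) : 1 ≤ ‖latticePoint k‖ₑ := by
  obtain ⟨i, hi⟩ := Function.ne_iff.1 hk
  have h1 : ‖(k i : ℝ)‖ ≤ ‖latticePoint k‖ := PiLp.norm_apply_le (latticePoint k) i
  have h2 : (1 : ℝ) ≤ ‖(k i : ℝ)‖ := by
    rw [Real.norm_eq_abs]
    exact_mod_cast Int.one_le_abs hi
  rw [← ofReal_norm]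
  exact ENNReal.one_le_ofReal.2 (h2.trans h1)

theorem lintegral_count_weight_eq (s θ : ℝ) (μ : Measure (EuclideanSpace ℝ (Fin d))) :
    ∫⁻ k : Fin d → ℤ, ‖fourierTransform μ (latticePoint k)‖ₑ ^ (2 / θ) *
      max 1 ‖latticePoint k‖ₑ ^ (s / θ - d) ∂Measure.count =
      ‖fourierTransform μ 0‖ₑ ^ (2 / θ) + latticeSum s θ μ := by
  rw [lintegral_count, ← ENNReal.summable.tsum_add_tsum_compl (s := {0}) ENNReal.summable]
  congr 1
  · refine (tsum_singleton (0 : Fin d → ℤ) fun k =>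
      ‖fourierTransform μ (latticePoint k)‖ₑ ^ (2 / θ) * max 1 ‖latticePoint k‖ₑ ^ (s / θ - d)).trans ?_
    rw [latticePoint_zero]
    simp
  · refine tsum_congr fun k => ?_
    have hk : k.1 ≠ 0 := k.2
    rw [max_eq_right (one_le_enorm_latticePoint hk)]

theorem measurable_enorm_fourierTransform (μ : Measure (EuclideanSpace ℝ (Fin d)))
    [IsFiniteMeasure μ] : Measurable fun z => ‖fourierTransform μ z‖ₑ :=
  (continuous_fourierTransform μ).enorm.measurable

theorem exists_truncatedIntegral_equiv (hd : 0 < d) {δ : ℝ} (hδ : 0 < δ) (hδ' : δ < 1 / 2) {s : ℝ}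
    (hs : 0 < s) :
    ∃ M : ℝ≥0, ∀ θ ∈ Ioc (0 : ℝ) 1, ∀ (μ : Measure (EuclideanSpace ℝ (Fin d)))
      [IsFiniteMeasure μ], μ.support ⊆ innerCube d δ →
        truncatedIntegral s θ μ ≤
          (M : ℝ≥0∞) ^ (1 / θ) * (‖fourierTransform μ 0‖ₑ ^ (2 / θ) + latticeSum s θ μ) ∧
        ‖fourierTransform μ 0‖ₑ ^ (2 / θ) + latticeSum s θ μ ≤
          (M : ℝ≥0∞) ^ (1 / θ) * truncatedIntegral s θ μ := by
  -- The Schur test is used with `τ = s/2`, `D = d` and `p = 2/θ`, so that `τ * p - D = s/θ - d`.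
  obtain ⟨C, hC⟩ := exists_enorm_fourierTransform_le d hδ hδ' (r := s / 2 + d + d + 1)
    (by positivity)
  have hfin₁ := lintegral_one_add_enorm_rpow_neg_lt_top (d := d) (r := d + 1) (by linarith)
  have hfin₂ := lintegral_one_add_enorm_latticePoint_lt_top hd (r := d + 1) (by linarith)
  set A₁ := ∫⁻ y : EuclideanSpace ℝ (Fin d), (1 + ‖y‖ₑ) ^ (-((d : ℝ) + 1))
  set A₂ := ∫⁻ k : Fin d → ℤ, (1 + ‖latticePoint k‖ₑ) ^ (-((d : ℝ) + 1)) ∂Measure.count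
  set M : ℝ≥0∞ := C * A₁ + C * ((1 + (d : ℝ≥0∞)) ^ ((d : ℝ) + 1) * A₂) with hM
  have hMtop : M ≠ ∞ := by
    have : (1 + (d : ℝ≥0∞)) ^ ((d : ℝ) + 1) ≠ ∞ :=
      ENNReal.rpow_ne_top_of_nonneg (by positivity) (by simp)
    exact ENNReal.add_ne_top.2 ⟨ENNReal.mul_ne_top (by simp) hfin₁.ne,
      ENNReal.mul_ne_top (by simp) (ENNReal.mul_ne_top this hfin₂.ne)⟩
  have hM₁ : ∀ z : EuclideanSpace ℝ (Fin d),
      ∫⁻ y, C * (1 + ‖z - y‖ₑ) ^ (-((d : ℝ) + 1)) ≤ M := fun z => by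
    rw [lintegral_const_mul _ (by fun_prop), lintegral_sub_left_eq_self
      (fun y : EuclideanSpace ℝ (Fin d) => (1 + ‖y‖ₑ) ^ (-((d : ℝ) + 1)))]
    exact le_self_add
  have hM₂ : ∀ z : EuclideanSpace ℝ (Fin d), ∫⁻ k : Fin d → ℤ,
      C * (1 + ‖z - latticePoint k‖ₑ) ^ (-((d : ℝ) + 1)) ∂Measure.count ≤ M := fun z => by
    rw [lintegral_const_mul _ (measurable_of_countable _)]
    refine le_trans ?_ le_add_self
    gcongr
    exact lintegral_one_add_enorm_sub_latticePoint_le (by positivity) z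
  refine ⟨M.toNNReal ^ 2, fun θ hθ μ _ hμ => ?_⟩
  have hp : 1 < 2 / θ := (one_lt_div hθ.1).2 (by linarith [hθ.2])
  have hexp : s / 2 * (2 / θ) - d = s / θ - d := by ring
  have hMp : ((M.toNNReal ^ 2 : ℝ≥0) : ℝ≥0∞) ^ (1 / θ) = M ^ (2 / θ) := by
    rw [ENNReal.coe_pow, ENNReal.coe_toNNReal hMtop, ← ENNReal.rpow_natCast, ← ENNReal.rpow_mul]
    congr 1
    push_cast
    ring
  have hg := measurable_enorm_fourierTransform μ
  rw [hMp, ← lintegral_count_weight_eq, truncatedIntegral, ← hexp]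
  -- One Schur test serves both directions, with Lebesgue and counting measure exchanged.
  exact ⟨lintegral_rpow_mul_weight_le measurable_id measurable_latticePoint hg (by positivity)
      (by positivity) hp (fun z => (hC μ hμ z).2) hM₁ hM₂,
    lintegral_rpow_mul_weight_le measurable_latticePoint measurable_id hg (by positivity)
      (by positivity) hp (fun z => (hC μ hμ z).1) hM₂ hM₁⟩

/-! ### The contribution of the unit ball -/

theorem fourierTransform_zero (μ : Measure (EuclideanSpace ℝ (Fin d))) :
    fourierTransform μ 0 = μ.real univ := by
  simp [fourierTransform_eq_integral_unitExp]

theorem norm_fourierTransform_le (μ : Measure (EuclideanSpace ℝ (Fin d)))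
    (z : EuclideanSpace ℝ (Fin d)) : ‖fourierTransform μ z‖ ≤ ‖fourierTransform μ 0‖ := by
  rw [fourierTransform_zero, fourierTransform_eq_integral_unitExp]
  refine (norm_integral_le_integral_norm _).trans ?_
  simp [abs_of_nonneg measureReal_nonneg]

theorem enorm_fourierTransform_le (μ : Measure (EuclideanSpace ℝ (Fin d)))
    (z : EuclideanSpace ℝ (Fin d)) : ‖fourierTransform μ z‖ₑ ≤ ‖fourierTransform μ 0‖ₑ := by
  rw [← ofReal_norm, ← ofReal_norm]
  exact ENNReal.ofReal_le_ofReal (norm_fourierTransform_le μ z)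

theorem norm_le_of_mem_innerCube {δ : ℝ} (hδ : 0 < δ) {x : EuclideanSpace ℝ (Fin d)}
    (hx : x ∈ innerCube d δ) : ‖x‖ ≤ d := by
  have h : ‖x‖ₑ ≤ d := by
    refine (enorm_le_sum_enorm x).trans ((Finset.sum_le_sum (g := fun _ => 1) fun i _ => ?_).trans
      (by simp))
    rw [← ofReal_norm, ENNReal.ofReal_le_one, Real.norm_of_nonneg (hδ.le.trans (hx i).1)]
    linarith [(hx i).2]
  rw [← ofReal_norm] at h
  exact (ENNReal.ofReal_le_natCast).1 h

/-- On the support `|x| ≤ d`, so `|exp(-2πi⟪x, z⟫) - 1| ≤ 2πd|z| ≤ 1/2`: the transform loses at most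
half of the mass. -/
theorem norm_fourierTransform_zero_le_two_mul (hd : 0 < d) {δ : ℝ} (hδ : 0 < δ)
    (μ : Measure (EuclideanSpace ℝ (Fin d))) [IsFiniteMeasure μ] (hμ : μ.support ⊆ innerCube d δ)
    {z : EuclideanSpace ℝ (Fin d)} (hz : ‖z‖ ≤ 1 / (4 * Real.pi * d)) :
    ‖fourierTransform μ 0‖ ≤ 2 * ‖fourierTransform μ z‖ := by
  have hd' : (0 : ℝ) < d := by exact_mod_cast hd
  have hint : Integrable (fun x => unitExp (-⟪x, z⟫)) μ :=
    Integrable.of_bound (continuous_unitExp.comp (by fun_prop)).aestronglyMeasurable 1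
      (ae_of_all _ fun x => (norm_unitExp _).le)
  have hdiff : ‖fourierTransform μ z - fourierTransform μ 0‖ ≤ 1 / 2 * μ.real univ := by
    have h0 : fourierTransform μ 0 = ∫ _, (1 : ℂ) ∂μ := by
      rw [fourierTransform_zero]; simp
    rw [h0, fourierTransform_eq_integral_unitExp, ← integral_sub hint (integrable_const _)]
    refine norm_integral_le_of_norm_le_const ?_
    filter_upwards [ae_mem_innerCube hμ] with x hx
    refine (norm_unitExp_sub_one_le _).trans ?_
    rw [abs_neg]
    calc 2 * Real.pi * |⟪x, z⟫| ≤ 2 * Real.pi * (d * (1 / (4 * Real.pi * d))) := by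
          have := Real.pi_pos
          gcongr
          exact (abs_real_inner_le_norm x z).trans
            (mul_le_mul (norm_le_of_mem_innerCube hδ hx) hz (norm_nonneg _) hd'.le)
      _ = 1 / 2 := by field_simp; norm_num
  have h0 : ‖fourierTransform μ 0‖ = μ.real univ := by
    rw [fourierTransform_zero]
    simp [abs_of_nonneg measureReal_nonneg]
  have htri := norm_sub_norm_le (fourierTransform μ 0) (fourierTransform μ z)
  rw [norm_sub_rev] at htri
  linarith

theorem lintegral_ball_enorm_rpow_lt_top (hd : 0 < d) {s : ℝ} (hs : 0 < s) :
    ∫⁻ z in Metric.ball (0 : EuclideanSpace ℝ (Fin d)) 1, ‖z‖ₑ ^ (s - d) < ∞ := by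
  have : Nonempty (Fin d) := ⟨⟨0, hd⟩⟩
  have h : IntegrableOn (fun z : EuclideanSpace ℝ (Fin d) => ‖z‖ ^ (s - d)) (Metric.ball 0 1) := by
    refine integrableOn_ball_of_norm_le_rpow (C := 1) (α := d - s)
      (by simpa using Nat.one_le_iff_ne_zero.2 hd.ne') (by simpa using hs) (ae_of_all _ fun z => ?_) (Measurable.aestronglyMeasurable (by fun_prop))
    rw [Real.norm_of_nonneg (by positivity), neg_sub, one_mul]
  refine lt_of_le_of_lt ?_ h.hasFiniteIntegral
  refine lintegral_mono_ae (ae_restrict_of_ae ?_)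
  filter_upwards [compl_mem_ae_iff.2 (measure_singleton (0 : EuclideanSpace ℝ (Fin d)))] with z hz
  have hz' : 0 < ‖z‖ := norm_pos_iff.2 hz
  rw [Real.enorm_of_nonneg (by positivity), ← ENNReal.ofReal_rpow_of_pos hz', ofReal_norm]

theorem lintegral_compl_ball_weight_eq (s θ : ℝ) (μ : Measure (EuclideanSpace ℝ (Fin d))) :
    ∫⁻ z in (Metric.ball 0 1)ᶜ, ‖fourierTransform μ z‖ₑ ^ (2 / θ) * max 1 ‖z‖ₑ ^ (s / θ - d) =
      ∫⁻ z in (Metric.ball 0 1)ᶜ, ‖fourierTransform μ z‖ₑ ^ (2 / θ) * ‖z‖ₑ ^ (s / θ - d) := by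
  refine setLIntegral_congr_fun Metric.isOpen_ball.measurableSet.compl fun z hz => ?_
  have : 1 ≤ ‖z‖ₑ := by
    rw [← ofReal_norm]
    exact ENNReal.one_le_ofReal.2 (by simpa using hz)
  simp only [max_eq_right this]

theorem lintegral_energy_le {s θ : ℝ} (hs : 0 < s) (hθ : θ ∈ Ioc (0 : ℝ) 1)
    (μ : Measure (EuclideanSpace ℝ (Fin d))) :
    ∫⁻ z, ‖fourierTransform μ z‖ₑ ^ (2 / θ) * ‖z‖ₑ ^ (s / θ - d) ≤
      (∫⁻ z in Metric.ball (0 : EuclideanSpace ℝ (Fin d)) 1, ‖z‖ₑ ^ (s - d)) *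
        ‖fourierTransform μ 0‖ₑ ^ (2 / θ) + truncatedIntegral s θ μ := by
  have hp : 0 ≤ 2 / θ := div_nonneg zero_le_two hθ.1.le
  rw [← lintegral_add_compl _ (Metric.isOpen_ball (x := 0) (ε := 1)).measurableSet,
    ← lintegral_compl_ball_weight_eq]
  refine add_le_add ?_ (setLIntegral_le_lintegral _ _)
  rw [← lintegral_mul_const _ (by fun_prop)]
  refine setLIntegral_mono (by fun_prop) fun z hz => ?_
  rw [mul_comm]
  have hz1 : ‖z‖ₑ ≤ 1 := by
    rw [← ofReal_norm, ENNReal.ofReal_le_one]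
    simpa using (Metric.mem_ball.1 hz).le
  gcongr ?_ * ?_ ^ (2 / θ)
  -- Since `|z| ≤ 1` and `s ≤ s/θ`, the weight is bounded by one that does not depend on `θ`.
  · refine ENNReal.rpow_le_rpow_of_exponent_ge hz1 ?_
    have : s ≤ s / θ := le_div_self hs.le hθ.1 hθ.2
    linarith
  · exact enorm_fourierTransform_le μ z

theorem truncatedIntegral_le {s θ : ℝ} (hθ : 0 < θ) (μ : Measure (EuclideanSpace ℝ (Fin d))) :
    truncatedIntegral s θ μ ≤
      volume (Metric.ball (0 : EuclideanSpace ℝ (Fin d)) 1) * ‖fourierTransform μ 0‖ₑ ^ (2 / θ) +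
        ∫⁻ z, ‖fourierTransform μ z‖ₑ ^ (2 / θ) * ‖z‖ₑ ^ (s / θ - d) := by
  rw [truncatedIntegral, ← lintegral_add_compl _ (Metric.isOpen_ball (x := 0)
    (ε := 1)).measurableSet, lintegral_compl_ball_weight_eq]
  refine add_le_add ?_ (setLIntegral_le_lintegral _ _)
  rw [mul_comm, ← setLIntegral_const]
  refine setLIntegral_mono measurable_const fun z hz => ?_
  have hz1 : ‖z‖ₑ ≤ 1 := by
    rw [← ofReal_norm, ENNReal.ofReal_le_one]
    simpa using (Metric.mem_ball.1 hz).le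
  rw [max_eq_left hz1, ENNReal.one_rpow, mul_one]
  gcongr
  exact enorm_fourierTransform_le μ z

/-- Writes a fixed constant in the form `A ^ (1/θ)`, which the outer power `θ` turns into `A`. It
suffices that `A ≥ 1` and `A ≥ a`, as `1/θ ≥ 1`. -/
theorem exists_le_rpow_one_div {a : ℝ≥0∞} (ha : a ≠ ∞) :
    ∃ A : ℝ≥0, ∀ θ ∈ Ioc (0 : ℝ) 1, a ≤ (A : ℝ≥0∞) ^ (1 / θ) := by
  refine ⟨max 1 a.toNNReal, fun θ hθ => ?_⟩
  have h1 : (1 : ℝ≥0∞) ≤ (max 1 a.toNNReal : ℝ≥0) := by exact_mod_cast le_max_left _ _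
  calc a = a.toNNReal := (ENNReal.coe_toNNReal ha).symm
    _ ≤ (max 1 a.toNNReal : ℝ≥0) := by exact_mod_cast le_max_right _ _
    _ = ((max 1 a.toNNReal : ℝ≥0) : ℝ≥0∞) ^ (1 : ℝ) := (ENNReal.rpow_one _).symm
    _ ≤ _ := ENNReal.rpow_le_rpow_of_exponent_le h1 ((one_le_div hθ.1).2 hθ.2)

/-- The total mass is controlled by the energy integral over a fixed annulus near the origin. -/
theorem exists_enorm_fourierTransform_zero_rpow_le (hd : 0 < d) {δ : ℝ} (hδ : 0 < δ) {s : ℝ}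
    (hs : 0 < s) :
    ∃ B : ℝ≥0, ∀ θ ∈ Ioc (0 : ℝ) 1, ∀ (μ : Measure (EuclideanSpace ℝ (Fin d)))
      [IsFiniteMeasure μ], μ.support ⊆ innerCube d δ →
        ‖fourierTransform μ 0‖ₑ ^ (2 / θ) ≤
          (B : ℝ≥0∞) ^ (1 / θ) *
            ∫⁻ z, ‖fourierTransform μ z‖ₑ ^ (2 / θ) * ‖z‖ₑ ^ (s / θ - d) := by
  have hd' : (1 : ℝ) ≤ d := by exact_mod_cast hd
  set c : ℝ := 1 / (4 * Real.pi * d) with hc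
  have hc0 : 0 < c := by positivity
  have hc1 : c ≤ 1 := by
    rw [hc, div_le_one (by positivity)]
    nlinarith [Real.pi_gt_three]
  -- The outer radius keeps `|μ̂|` above half the mass; the inner radius keeps `|z| ^ (s/θ)` bounded
  -- below.
  let S : Set (EuclideanSpace ℝ (Fin d)) := {z | c / 2 < ‖z‖ ∧ ‖z‖ < c}
  have hSo : IsOpen S :=
    (isOpen_lt continuous_const continuous_norm).inter (isOpen_lt continuous_norm continuous_const)
  have hSpos : volume S ≠ 0 := by
    refine (hSo.measure_pos volume ⟨EuclideanSpace.single ⟨0, hd⟩ (3 * c / 4), ?_⟩).ne'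
    simp only [S, mem_ofPred_eq, PiLp.norm_single, Real.norm_eq_abs,
      abs_of_pos (by positivity : 0 < 3 * c / 4)]
    constructor <;> linarith
  have hStop : volume S ≠ ∞ := by
    refine ((measure_mono fun z hz => ?_).trans_lt
      (measure_ball_lt_top (x := (0 : EuclideanSpace ℝ (Fin d))) (r := c))).ne
    simpa using hz.2
  obtain ⟨A, hA⟩ := exists_le_rpow_one_div (ENNReal.inv_ne_top.2 hSpos)
  let b : ℝ≥0 := (c / 2).toNNReal
  have hb : (b : ℝ≥0∞) = ENNReal.ofReal (c / 2) := rfl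
  have hb0 : (b : ℝ≥0∞) ≠ 0 := by
    rw [hb]
    exact (ENNReal.ofReal_pos.2 (by positivity)).ne'
  -- The base of the final constant: `A` accounts for `1 / volume S`, `2 ^ 2` for losing half the
  -- mass, and `b ^ (-s)` for the weight on `S`.
  have hK : (A * (2 ^ (2 : ℝ) * ((b : ℝ≥0∞) ^ s)⁻¹) : ℝ≥0∞) ≠ ∞ := by
    refine ENNReal.mul_ne_top (by simp) (ENNReal.mul_ne_top (by simp) ?_)
    exact ENNReal.inv_ne_top.2 (by simp [ENNReal.rpow_eq_zero_iff, hb0])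
  refine ⟨(A * (2 ^ (2 : ℝ) * ((b : ℝ≥0∞) ^ s)⁻¹) : ℝ≥0∞).toNNReal, fun θ hθ μ _ hμ => ?_⟩
  rw [ENNReal.coe_toNNReal hK]
  have hθ0 : 0 ≤ 1 / θ := one_div_nonneg.2 hθ.1.le
  have hp : 0 ≤ 2 / θ := div_nonneg zero_le_two hθ.1.le
  set g₀ := ‖fourierTransform μ 0‖ₑ
  have hlow : ∀ z ∈ S, g₀ ^ (2 / θ) * (b : ℝ≥0∞) ^ (s / θ) ≤
      2 ^ (2 / θ) * (‖fourierTransform μ z‖ₑ ^ (2 / θ) * ‖z‖ₑ ^ (s / θ - d)) := by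
    intro z hz
    have h1 : g₀ ≤ 2 * ‖fourierTransform μ z‖ₑ := by
      have := ENNReal.ofReal_le_ofReal
        (norm_fourierTransform_zero_le_two_mul hd hδ μ hμ (hz.2.le.trans_eq hc))
      rwa [ENNReal.ofReal_mul zero_le_two, ofReal_norm, ofReal_norm, ENNReal.ofReal_ofNat] at this
    have hz1 : ‖z‖ₑ ≤ 1 := by
      rw [← ofReal_norm, ENNReal.ofReal_le_one]
      exact hz.2.le.trans hc1
    have hbz : (b : ℝ≥0∞) ≤ ‖z‖ₑ := by
      rw [hb, ← ofReal_norm]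
      exact ENNReal.ofReal_le_ofReal hz.1.le
    rw [← mul_assoc, ← ENNReal.mul_rpow_of_nonneg _ _ hp]
    refine mul_le_mul' (ENNReal.rpow_le_rpow h1 hp) ?_
    refine (ENNReal.rpow_le_rpow hbz (div_nonneg hs.le hθ.1.le)).trans ?_
    exact ENNReal.rpow_le_rpow_of_exponent_ge hz1 (by linarith)
  have hint : g₀ ^ (2 / θ) * (b : ℝ≥0∞) ^ (s / θ) * volume S ≤ 2 ^ (2 / θ) *
      ∫⁻ z, ‖fourierTransform μ z‖ₑ ^ (2 / θ) * ‖z‖ₑ ^ (s / θ - d) := by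
    have hg := measurable_enorm_fourierTransform μ
    rw [← setLIntegral_const, ← lintegral_const_mul _ (by fun_prop)]
    exact (setLIntegral_mono (by fun_prop) hlow).trans (setLIntegral_le_lintegral _ _)
  set I := ∫⁻ z, ‖fourierTransform μ z‖ₑ ^ (2 / θ) * ‖z‖ₑ ^ (s / θ - d)
  have hbs : (b : ℝ≥0∞) ^ (s / θ) ≠ 0 := by simp [ENNReal.rpow_eq_zero_iff, hb0]
  have hbt : (b : ℝ≥0∞) ^ (s / θ) ≠ ∞ :=
    ENNReal.rpow_ne_top_of_nonneg (div_nonneg hs.le hθ.1.le) (by simp)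
  have hpow : (A * (2 ^ (2 : ℝ) * ((b : ℝ≥0∞) ^ s)⁻¹) : ℝ≥0∞) ^ (1 / θ) =
      (A : ℝ≥0∞) ^ (1 / θ) * (2 ^ (2 / θ) * ((b : ℝ≥0∞) ^ (s / θ))⁻¹) := by
    rw [ENNReal.mul_rpow_of_nonneg _ _ hθ0, ENNReal.mul_rpow_of_nonneg _ _ hθ0, ENNReal.inv_rpow,
      ← ENNReal.rpow_mul, ← ENNReal.rpow_mul, mul_one_div, mul_one_div]
  rw [hpow]
  calc g₀ ^ (2 / θ) = g₀ ^ (2 / θ) * ((b : ℝ≥0∞) ^ (s / θ) * ((b : ℝ≥0∞) ^ (s / θ))⁻¹) *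
        (volume S * (volume S)⁻¹) := by
        rw [ENNReal.mul_inv_cancel hbs hbt, ENNReal.mul_inv_cancel hSpos hStop, mul_one, mul_one]
    _ = (volume S)⁻¹ * (((b : ℝ≥0∞) ^ (s / θ))⁻¹ *
        (g₀ ^ (2 / θ) * (b : ℝ≥0∞) ^ (s / θ) * volume S)) := by ring
    _ ≤ (A : ℝ≥0∞) ^ (1 / θ) * (((b : ℝ≥0∞) ^ (s / θ))⁻¹ * (2 ^ (2 / θ) * I)) := by
        gcongr
        exact hA θ hθ
    _ = _ := by ring

/-! ### Uniform comparison of the energies -/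

theorem rpow_le_of_le_add {θ : ℝ} (hθ : θ ∈ Ioc (0 : ℝ) 1) {I D : ℝ≥0∞} {a b : ℝ≥0}
    (h : I ≤ (a : ℝ≥0∞) ^ (1 / θ) * D + (b : ℝ≥0∞) ^ (1 / θ) * D) :
    I ^ θ ≤ (a + b : ℝ≥0) * D ^ θ := by
  have hcancel : ∀ x : ℝ≥0, ((x : ℝ≥0∞) ^ (1 / θ) * D) ^ θ = x * D ^ θ := fun x => by
    rw [ENNReal.mul_rpow_of_nonneg _ _ hθ.1.le, ← ENNReal.rpow_mul, one_div_mul_cancel hθ.1.ne',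
      ENNReal.rpow_one]
  -- For `θ ≤ 1` the map `x ↦ x ^ θ` is subadditive.
  refine (ENNReal.rpow_le_rpow h hθ.1.le).trans
    ((ENNReal.rpow_add_le_add_rpow _ _ hθ.1.le hθ.2).trans_eq ?_)
  rw [hcancel, hcancel, ENNReal.coe_add, add_mul]

theorem exists_energy_equiv (hd : 0 < d) {δ : ℝ} (hδ : 0 < δ) (hδ' : δ < 1 / 2) {s : ℝ}
    (hs : 0 < s) :
    ∃ C : ℝ≥0, 0 < C ∧ ∀ θ ∈ Ioc (0 : ℝ) 1, ∀ (μ : Measure (EuclideanSpace ℝ (Fin d)))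
      [IsFiniteMeasure μ], μ.support ⊆ innerCube d δ →
        energy s θ μ ≤ C * discreteEnergy s θ μ ∧ discreteEnergy s θ μ ≤ C * energy s θ μ := by
  obtain ⟨M, hM⟩ := exists_truncatedIntegral_equiv hd hδ hδ' hs
  obtain ⟨A, hA⟩ := exists_le_rpow_one_div (lintegral_ball_enorm_rpow_lt_top hd hs).ne
  obtain ⟨V, hV⟩ := exists_le_rpow_one_div
    (measure_ball_lt_top (μ := volume) (x := (0 : EuclideanSpace ℝ (Fin d))) (r := 1)).ne
  obtain ⟨B, hB⟩ := exists_enorm_fourierTransform_zero_rpow_le hd hδ hs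
  -- `A + M` serves the first inequality, `M * (V * B) + M` the second, and `1` makes the constant
  -- positive.
  refine ⟨(A + M) + (M * (V * B) + M) + 1, by positivity, fun θ hθ μ _ hμ => ?_⟩
  have hθ0 : 0 ≤ 1 / θ := one_div_nonneg.2 hθ.1.le
  obtain ⟨hM1, hM2⟩ := hM θ hθ μ hμ
  constructor
  · have h : energy s θ μ ≤ (A + M : ℝ≥0) * discreteEnergy s θ μ := by
      refine rpow_le_of_le_add hθ ((lintegral_energy_le hs hθ μ).trans (add_le_add ?_ hM1))
      exact mul_le_mul' (hA θ hθ) le_self_add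
    refine h.trans ?_
    gcongr ?_ * _
    rw [ENNReal.coe_le_coe, add_assoc]
    exact le_self_add
  · have h : discreteEnergy s θ μ ≤ (M * (V * B) + M : ℝ≥0) * energy s θ μ := by
      refine rpow_le_of_le_add hθ (hM2.trans ?_)
      rw [ENNReal.coe_mul, ENNReal.coe_mul, ENNReal.mul_rpow_of_nonneg _ _ hθ0,
        ENNReal.mul_rpow_of_nonneg _ _ hθ0, mul_assoc, ← mul_add]
      gcongr
      refine (truncatedIntegral_le hθ.1 μ).trans (add_le_add ?_ le_rfl)
      rw [mul_assoc]
      exact mul_le_mul' (hV θ hθ) (hB θ hθ μ hμ)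
    refine h.trans ?_
    gcongr ?_ * _
    rw [ENNReal.coe_le_coe]
    exact le_add_self.trans le_self_add

/-! ### The Fourier spectrum from lattice sums -/

theorem discreteEnergy_lt_top_iff {s θ : ℝ} (hθ : 0 < θ)
    (μ : Measure (EuclideanSpace ℝ (Fin d))) :
    discreteEnergy s θ μ < ∞ ↔ latticeSum s θ μ < ∞ := by
  have h : ‖fourierTransform μ 0‖ₑ ^ (2 / θ) ≠ ∞ :=
    ENNReal.rpow_ne_top_of_nonneg (div_nonneg zero_le_two hθ.le) enorm_ne_top
  rw [discreteEnergy, ENNReal.rpow_lt_top_iff_of_pos hθ, ENNReal.add_lt_top]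
  exact ⟨fun h => h.2, fun h' => ⟨h.lt_top, h'⟩⟩

theorem energy_lt_top_iff (hd : 0 < d) {δ : ℝ} (hδ : 0 < δ) (hδ' : δ < 1 / 2) {s : ℝ} (hs : 0 < s)
    {θ : ℝ} (hθ : θ ∈ Ioc (0 : ℝ) 1) (μ : Measure (EuclideanSpace ℝ (Fin d))) [IsFiniteMeasure μ]
    (hμ : μ.support ⊆ innerCube d δ) : energy s θ μ < ∞ ↔ latticeSum s θ μ < ∞ := by
  obtain ⟨C, -, hC⟩ := exists_energy_equiv hd hδ hδ' hs
  obtain ⟨h1, h2⟩ := hC θ hθ μ hμ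
  rw [← discreteEnergy_lt_top_iff hθ.1]
  exact ⟨fun h => h2.trans_lt (ENNReal.mul_lt_top ENNReal.coe_lt_top h),
    fun h => h1.trans_lt (ENNReal.mul_lt_top ENNReal.coe_lt_top h)⟩

/-- The transform is bounded by its value at `0` and the exponent `s/θ - d` is below `-d`. The
factor `2 ^ (d - s/θ)` comes from `1 + |k| ≤ 2|k|` for `k ≠ 0`. -/
theorem latticeSum_lt_top_of_neg (hd : 0 < d) {s θ : ℝ} (hs : s < 0) (hθ : 0 < θ)
    (μ : Measure (EuclideanSpace ℝ (Fin d))) : latticeSum s θ μ < ∞ := by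
  have hr : (d : ℝ) < d - s / θ := by linarith [div_neg_of_neg_of_pos hs hθ]
  have hr0 : 0 ≤ d - s / θ := (Nat.cast_nonneg d).trans hr.le
  have hfin := lintegral_one_add_enorm_latticePoint_lt_top hd hr
  rw [lintegral_count] at hfin
  set K : ℝ≥0∞ := ‖fourierTransform μ 0‖ₑ ^ (2 / θ) * 2 ^ (d - s / θ)
  have hK : K < ∞ := (ENNReal.mul_ne_top
    (ENNReal.rpow_ne_top_of_nonneg (div_nonneg zero_le_two hθ.le) enorm_ne_top)
    (ENNReal.rpow_ne_top_of_nonneg hr0 (by simp))).lt_top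
  refine lt_of_le_of_lt ?_ (ENNReal.mul_lt_top hK hfin)
  refine le_trans ?_ (mul_le_mul' le_rfl
    (ENNReal.tsum_comp_le_tsum_of_injective (Subtype.val_injective (p := fun z => z ≠ 0)) _))
  rw [← ENNReal.tsum_mul_left]
  refine ENNReal.tsum_le_tsum fun k => ?_
  have hk := one_le_enorm_latticePoint k.2
  rw [mul_assoc]
  gcongr
  · exact enorm_fourierTransform_le μ _
  · rw [show s / θ - d = -(d - s / θ) by ring, ENNReal.rpow_neg, ENNReal.rpow_neg,
      ← div_eq_mul_inv, ← ENNReal.inv_div (by simp) (by simp), ENNReal.inv_le_inv]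
    refine ENNReal.div_le_of_le_mul ?_
    rw [← ENNReal.mul_rpow_of_nonneg _ _ hr0]
    gcongr
    rw [mul_two]
    gcongr

/-- The value `0` is approached through negative `s`; the sum at `s = 0` itself may diverge. This
matches the convention that the spectrum is `0` when no `s ≥ 0` is admissible. -/
theorem zero_le_iSup_latticeSum_lt_top (hd : 0 < d) {θ : ℝ} (hθ : 0 < θ)
    (μ : Measure (EuclideanSpace ℝ (Fin d))) :
    (0 : EReal) ≤ ⨆ (s : ℝ) (_ : latticeSum s θ μ < ∞), (s : EReal) := by
  refine le_of_forall_lt fun c hc => ?_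
  obtain ⟨x, hcx, hx⟩ := EReal.lt_iff_exists_real_btwn.1 hc
  refine hcx.trans_le (le_iSup₂_of_le x ?_ le_rfl)
  exact latticeSum_lt_top_of_neg hd (by exact_mod_cast hx) hθ μ

theorem fourierSpectrum_eq_iSup (hd : 0 < d) {δ : ℝ} (hδ : 0 < δ) (hδ' : δ < 1 / 2) {θ : ℝ}
    (hθ : θ ∈ Ioc (0 : ℝ) 1) (μ : Measure (EuclideanSpace ℝ (Fin d))) [IsFiniteMeasure μ]
    (hμ : μ.support ⊆ innerCube d δ) :
    (fourierSpectrum θ μ : EReal) = ⨆ (s : ℝ) (_ : latticeSum s θ μ < ∞), (s : EReal) := by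
  have h0 := zero_le_iSup_latticeSum_lt_top hd hθ.1 μ
  apply le_antisymm
  · rw [← EReal.coe_toENNReal h0, EReal.coe_ennreal_le_coe_ennreal_iff]
    refine iSup₂_le fun s hs => ?_
    -- The energy comparison needs `s > 0`; the value `s = 0` is covered by the nonnegativity of the
    -- right side.
    rcases eq_or_ne s 0 with rfl | hs0
    · simp
    · rw [← EReal.coe_ennreal_le_coe_ennreal_iff, EReal.coe_toENNReal h0]
      refine le_iSup₂_of_le (s : ℝ) ?_ (EReal.coe_nnreal_eq_coe_real s).le
      exact (energy_lt_top_iff hd hδ hδ' (by positivity) hθ μ hμ).1 hs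
  · refine iSup₂_le fun s hs => ?_
    rcases le_or_gt s 0 with hs0 | hs0
    · exact (EReal.coe_nonpos.2 hs0).trans (EReal.coe_ennreal_nonneg _)
    · lift s to ℝ≥0 using hs0.le
      have h := le_iSup₂_of_le (f := fun (s : ℝ≥0) (_ : energy s θ μ < ∞) => (s : ℝ≥0∞)) s
        ((energy_lt_top_iff hd hδ hδ' hs0 hθ μ hμ).2 hs) le_rfl
      exact (EReal.coe_nnreal_eq_coe_real s).ge.trans
        (EReal.coe_ennreal_le_coe_ennreal_iff.2 h)

end FourierCoeffs

theorem mainTheorem1 (d : ℕ) (hd : 0 < d) (δ : ℝ) (hδ : 0 < δ) (hδ' : δ < 1 / 2) :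
    (∀ s : ℝ, 0 < s → ∃ C : ℝ≥0, 0 < C ∧
      ∀ θ ∈ Ioc (0 : ℝ) 1, ∀ (μ : Measure (EuclideanSpace ℝ (Fin d))) [IsFiniteMeasure μ],
        μ.support ⊆ FourierCoeffs.innerCube d δ →
          FourierCoeffs.energy s θ μ ≤ C * FourierCoeffs.discreteEnergy s θ μ ∧
          FourierCoeffs.discreteEnergy s θ μ ≤ C * FourierCoeffs.energy s θ μ) ∧
    (∀ θ ∈ Ioc (0 : ℝ) 1, ∀ (μ : Measure (EuclideanSpace ℝ (Fin d))) [IsFiniteMeasure μ],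
      μ.support ⊆ FourierCoeffs.innerCube d δ →
        (FourierCoeffs.fourierSpectrum θ μ : EReal) =
          ⨆ (s : ℝ) (_ : FourierCoeffs.latticeSum s θ μ < ∞), (s : EReal)) :=
  ⟨fun _ hs => FourierCoeffs.exists_energy_equiv hd hδ hδ' hs,
    fun _ hθ μ _ hμ => FourierCoeffs.fourierSpectrum_eq_iSup hd hδ hδ' hθ μ hμ⟩
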